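/- Let $C$ be a multi-model Cantor set: a non-empty, compact, totally disconnected, perfect metric space with a partition into non-empty clopen sets $A_1,\dots,A_n$ (the models) and a second partition into non-empty clopen sets $E_1,\dots,E_m$ (the level-1 clones), such that each $E_k$ is contained in some model, each model contains at least two of the $E_k$, and for each $k$ there is a surjective map $\tau_k\colon E_k\to A_{t(k)}$ onto some model that multiplies all distances by a constant $s_k>1$; the index $t(k)$ is called the type of $E_k$. For $d>0$ let $M_d$ be the $n\times n$ matrix with entries $$(M_d)_{ij}=\sum_{k\,:\,t(k)=i,\ E_k\subseteq A_j} s_k^{-d}.$$ Suppose that $d>0$ is such that $M_d$ is irreducible, in the sense that its entries are non-negative and for some integer $k>0$ all entries of $M_d^{\,k}$ are positive, and that the Frobenius eigenvalue $\lambda_d$ of $M_d$ (the eigenvalue of largest modulus) equals $1$. Let $\mathcal H_d$ denote $d$-dimensional Hausdorff measure. Then $0<\mathcal H_d(C)<\infty$, and therefore $d$ is the Hausdorff dimension of $C$. Moreover, the vector $(\mathcal H_d(A_1),\dots,\mathcal H_d(A_n))$ is the Frobenius eigenvector of the transposed matrix $M_d^{T}$ normalized to sum to $\mathcal H_d(C)$: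 it has strictly positive coordinates with sum $\mathcal H_d(C)$ and satisfies $M_d^{T}v=v$, and if $v$ is any vector with strictly positive coordinates such that $M_d^{T}v=v$ and $\sum_{i=1}^n v_i=\mathcal H_d(C)$, then $v_i=\mathcal H_d(A_i)$ for all $i$. -/

import Mathlib

open MeasureTheory

namespace MultiModel

/-- A similarity map with scale factor `K`: a surjection between metric spaces multiplying all
distances by the constant `K > 0`. -/
structure IsSimilarityMap {X Y : Type*} [MetricSpace X] [MetricSpace Y] (K : ℝ) (f : X → Y) :
    Prop where
  pos : 0 < K
  surjective : Function.Surjective f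
  dist_eq : ∀ x₁ x₂ : X, dist (f x₁) (f x₂) = K * dist x₁ x₂

/-- A family of sets is a partition of `C` by clopens: the members are non-empty clopen sets,
pairwise disjoint, and they cover `C`. -/
structure IsClopenPartition {C ι : Type*} [TopologicalSpace C] (A : ι → Set C) : Prop where
  isClopen : ∀ i, IsClopen (A i)
  nonempty : ∀ i, (A i).Nonempty
  disjoint : Pairwise fun i j => Disjoint (A i) (A j)
  cover : ⋃ i, A i = Set.univ

/-- A clone structure with `n` models and `m` level-1 clones on a metric space `C`. A multi-model
Cantor set is a Cantor set (a non-empty, compact, totally disconnected, perfect metric space)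
together with a clone structure. -/
structure CloneStructure (C : Type*) [MetricSpace C] (n m : ℕ) where
  /-- The models `A₁, …, Aₙ`. -/
  model : Fin n → Set C
  model_partition : IsClopenPartition model
  /-- The level-1 clones `E₁, …, Eₘ`. -/
  clone : Fin m → Set C
  clone_partition : IsClopenPartition clone
  /-- The index of the model in which a level-1 clone is contained. -/
  loc : Fin m → Fin n
  clone_subset : ∀ k, clone k ⊆ model (loc k)
  /-- Every model contains at least two of the level-1 clones. -/
  two_le : ∀ j, ∃ k k', k ≠ k' ∧ clone k ⊆ model j ∧ clone k' ⊆ model j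
  /-- The type of a level-1 clone: the index of the model onto which it is mapped. -/
  type : Fin m → Fin n
  /-- The clone maps. -/
  τ : ∀ k, clone k → model (type k)
  /-- The scale factors of the clone maps. -/
  scale : Fin m → ℝ
  similarity : ∀ k, IsSimilarityMap (scale k) (τ k)
  /-- The clone maps are expanding: the inverse scale factors are less than one. -/
  one_lt_scale : ∀ k, 1 < scale k

/-- The matrix `M_d`. Its `i, j` entry is the sum of the `d`-th powers of the inverse scale factors
of the clone maps of the level-1 clones of type `i` contained in the model `j`. -/
noncomputable def CloneStructure.matrix {C : Type*} [MetricSpace C] {n m : ℕ}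
    (S : CloneStructure C n m) (d : ℝ) : Matrix (Fin n) (Fin n) ℝ :=
  Matrix.of fun i j => ∑ k with S.type k = i ∧ S.loc k = j, ((S.scale k)⁻¹) ^ d

/-- The real number `lam` is the Frobenius eigenvalue of the real matrix `M`: it is the eigenvalue
of largest modulus among all complex eigenvalues. -/
def IsFrobeniusEigenvalue {n : ℕ} (M : Matrix (Fin n) (Fin n) ℝ) (lam : ℝ) : Prop :=
  Module.End.HasEigenvalue (Matrix.toLin' (M.map Complex.ofReal)) (lam : ℂ) ∧
    ∀ μ : ℂ, Module.End.HasEigenvalue (Matrix.toLin' (M.map Complex.ofReal)) μ → ‖μ‖ ≤ lam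

/-- `v` is a Frobenius eigenvector of `M` for the eigenvalue `lam`: a real eigenvector with strictly
positive coordinates belonging to the Frobenius eigenvalue `lam`. -/
structure IsFrobeniusEigenvector {n : ℕ} (M : Matrix (Fin n) (Fin n) ℝ) (lam : ℝ)
    (v : Fin n → ℝ) : Prop where
  eigenvalue : IsFrobeniusEigenvalue M lam
  pos : ∀ i, 0 < v i
  eq : M.mulVec v = lam • v

end MultiModel

/-! Clone maps rescale `μH[d]` by `s_k ^ d`, so additivity makes the vector of measures of the
models a fixed point of the transposed matrix, but only in `[0, ∞]`: zero and infinity must be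
excluded. Perron–Frobenius theory supplies a positive finite fixed vector `w`, which serves as a
mass distribution on the models.

Finiteness: iterated preimages under the clone maps cover a model by sets of arbitrarily small
diameter, and since `w` is fixed the sum of `diam ^ d` stays below `K * w j` at every level
(`exists_cover`).

Positivity: every finite cover of a model has `∑ diam ^ d ≥ c * w j`
(`le_sum_ediam_rpow_of_subset`). A cover by small sets splits into disjoint, strictly smaller covers
of the clones; rescaling these to covers of models permits induction. Compactness reduces countable
covers to finite ones.

Once the measures are positive and finite, uniqueness of the positive fixed vector up to scaling
(`exists_smul_eq`) identifies them. -/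

open scoped ENNReal NNReal Matrix

/-! ### Perron–Frobenius theory for primitive matrices -/

section PerronFrobenius

namespace Matrix

variable {ι : Type*} [Fintype ι]

theorem IsPrimitive.transpose [DecidableEq ι] {N : Matrix ι ι ℝ} (hN : N.IsPrimitive) : Nᵀ.IsPrimitive := by
  obtain ⟨h0, k, hk, hpos⟩ := hN
  refine ⟨fun i j => h0 j i, k, hk, fun i j => ?_⟩
  rw [← transpose_pow]
  exact hpos j i

theorem mulVec_pos_of_pos {N : Matrix ι ι ℝ} (hN : ∀ i j, 0 < N i j) {x : ι → ℝ}
    (hx : ∀ i, 0 ≤ x i) (hx0 : x ≠ 0) (i : ι) : 0 < (N *ᵥ x) i := by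
  obtain ⟨j, hj⟩ := Function.ne_iff.1 hx0
  exact Finset.sum_pos' (fun l _ => mul_nonneg (hN i l).le (hx l))
    ⟨j, Finset.mem_univ _, mul_pos (hN i j) ((hx j).lt_of_ne' hj)⟩

theorem pow_mulVec_eq_pow_smul [DecidableEq ι] {N : Matrix ι ι ℝ} {x : ι → ℝ} {r : ℝ} (h : N *ᵥ x = r • x) (k : ℕ) :
    N ^ k *ᵥ x = r ^ k • x := by
  induction k with
  | zero => simp
  | succ k ih => rw [pow_succ, ← mulVec_mulVec, h, mulVec_smul, ih, smul_smul, pow_succ']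

theorem exists_lt_forall_mul_le {x y : ι → ℝ} {r : ℝ} (hx : ∀ i, 0 < x i)
    (h : ∀ i, r * x i < y i) : ∃ r' > r, ∀ i, r' * x i ≤ y i := by
  rcases isEmpty_or_nonempty ι with _ | _
  · exact ⟨r + 1, by simp, fun i => isEmptyElim i⟩
  · obtain ⟨i₀, hi₀⟩ := Finite.exists_min fun i => y i / x i
    exact ⟨y i₀ / x i₀, (lt_div_iff₀ (hx i₀)).2 (h i₀), fun i => (le_div_iff₀ (hx i)).1 (hi₀ i)⟩

/-- The Collatz–Wielandt set: pairs of a point `x` of the standard simplex and a number `r ≥ 0`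
with `r x ≤ N x`. -/
def collatzWielandt (N : Matrix ι ι ℝ) : Set ((ι → ℝ) × ℝ) :=
  {p | p.1 ∈ stdSimplex ℝ ι ∧ 0 ≤ p.2 ∧ ∀ i, p.2 * p.1 i ≤ (N *ᵥ p.1) i}

theorem isCompact_collatzWielandt {N : Matrix ι ι ℝ} (hN : ∀ i j, 0 ≤ N i j) :
    IsCompact (collatzWielandt N) := by
  have hK : IsCompact (stdSimplex ℝ ι ×ˢ Set.Icc (0 : ℝ) (∑ i, ∑ j, N i j)) :=
    (isCompact_stdSimplex ℝ ι).prod isCompact_Icc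
  refine hK.of_isClosed_subset ?_ ?_
  · have h1 : IsClosed {p : (ι → ℝ) × ℝ | p.1 ∈ stdSimplex ℝ ι} :=
      (isClosed_stdSimplex ℝ ι).preimage continuous_fst
    have h2 : IsClosed {p : (ι → ℝ) × ℝ | 0 ≤ p.2} := isClosed_le continuous_const continuous_snd
    have h3 : IsClosed {p : (ι → ℝ) × ℝ | ∀ i, p.2 * p.1 i ≤ (N *ᵥ p.1) i} := by
      simp only [Set.ofPred_forall]
      refine isClosed_iInter fun i => isClosed_le (by fun_prop) ?_
      exact (continuous_apply i).comp (Continuous.matrix_mulVec continuous_const continuous_fst)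
    exact h1.inter (h2.inter h3)
  -- Summing `r * x i ≤ (N *ᵥ x) i` over the simplex bounds `r` by the sum of all entries.
  · rintro ⟨x, r⟩ ⟨hx, hr, h⟩
    refine ⟨hx, hr, ?_⟩
    have hle : ∀ j, x j ≤ 1 := fun j =>
      (Finset.single_le_sum (fun i _ => hx.1 i) (Finset.mem_univ j)).trans_eq hx.2
    calc r = ∑ i, r * x i := by rw [← Finset.mul_sum, hx.2, mul_one]
      _ ≤ ∑ i, (N *ᵥ x) i := Finset.sum_le_sum fun i _ => h i
      _ ≤ ∑ i, ∑ j, N i j := Finset.sum_le_sum fun i _ => Finset.sum_le_sum fun j _ =>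
          mul_le_of_le_one_right (hN i j) (hle j)

theorem div_sum_mem_collatzWielandt {N : Matrix ι ι ℝ} {x : ι → ℝ} {r : ℝ}
    (hx : ∀ i, 0 ≤ x i) (hx0 : x ≠ 0) (hr : 0 ≤ r) (h : ∀ i, r * x i ≤ (N *ᵥ x) i) :
    ((∑ i, x i)⁻¹ • x, r) ∈ collatzWielandt N := by
  have hs : 0 < ∑ i, x i := by
    obtain ⟨j, hj⟩ := Function.ne_iff.1 hx0
    exact Finset.sum_pos' (fun i _ => hx i) ⟨j, Finset.mem_univ _, (hx j).lt_of_ne' hj⟩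
  refine ⟨⟨fun i => mul_nonneg (inv_nonneg.2 hs.le) (hx i), ?_⟩, hr, fun i => ?_⟩
  · simp only [Pi.smul_apply, smul_eq_mul, ← Finset.mul_sum, inv_mul_cancel₀ hs.ne']
  · simp only [mulVec_smul, Pi.smul_apply, smul_eq_mul]
    rw [mul_left_comm]
    exact mul_le_mul_of_nonneg_left (h i) (inv_nonneg.2 hs.le)

/-- If a primitive matrix `N` satisfies `x ≤ N x` for some nonzero `x ≥ 0`, then it has an
eigenvalue at least one with a positive eigenvector. -/
theorem IsPrimitive.exists_pos_eigenvector [DecidableEq ι] {N : Matrix ι ι ℝ} (hN : N.IsPrimitive) {x : ι → ℝ}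
    (hx : ∀ i, 0 ≤ x i) (hx0 : x ≠ 0) (h : ∀ i, x i ≤ (N *ᵥ x) i) :
    ∃ r : ℝ, 1 ≤ r ∧ ∃ v : ι → ℝ, v ≠ 0 ∧ (∀ i, 0 < v i) ∧ N *ᵥ v = r • v := by
  have hmem := div_sum_mem_collatzWielandt hx hx0 zero_le_one (by simpa using h)
  obtain ⟨⟨v, r⟩, ⟨hv, hr, hvr⟩, hmax⟩ := (isCompact_collatzWielandt hN.nonneg).exists_isMaxOn
    ⟨_, hmem⟩ continuous_snd.continuousOn
  obtain ⟨k, -, hk⟩ := hN.exists_pos_pow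
  have hr1 : 1 ≤ r := hmax hmem
  have hv0 : v ≠ 0 := by
    rintro rfl
    simpa using hv.2
  have hpos := mulVec_pos_of_pos hk hv.1 hv0
  have heig : N *ᵥ v = r • v := by
    -- Otherwise `N ^ k` turns the nonzero defect `N v - r v ≥ 0` into a strictly positive one, so
    -- `N ^ k v` admits a larger `r'`, against maximality.
    by_contra hne
    have hpos' := mulVec_pos_of_pos hk (x := N *ᵥ v - r • v)
      (fun i => by simpa using hvr i) (sub_ne_zero.2 hne)
    have hlt : ∀ i, r * (N ^ k *ᵥ v) i < (N *ᵥ (N ^ k *ᵥ v)) i := fun i => by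
      have := hpos' i
      rw [mulVec_sub, mulVec_smul, mulVec_mulVec, ← pow_succ, pow_succ', ← mulVec_mulVec] at this
      simpa using this
    obtain ⟨r', hr', hle⟩ := exists_lt_forall_mul_le hpos hlt
    have : r' ≤ r := hmax (div_sum_mem_collatzWielandt (fun i => (hpos i).le)
      (fun h0 => hv0 ?_) (hr.trans hr'.le) hle)
    · exact this.not_gt hr'
    · funext i
      exact absurd (congrFun h0 i) (hpos i).ne'
  refine ⟨r, hr1, v, hv0, fun i => ?_, heig⟩
  have := hpos i
  rw [pow_mulVec_eq_pow_smul heig] at this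
  exact pos_of_mul_pos_right this (pow_nonneg hr k)

/-- Positive fixed vectors of a primitive matrix are proportional. -/
theorem IsPrimitive.exists_smul_eq [DecidableEq ι] {N : Matrix ι ι ℝ} (hN : N.IsPrimitive) [Nonempty ι]
    {v w : ι → ℝ} (hw : ∀ i, 0 < w i) (hNv : N *ᵥ v = v) (hNw : N *ᵥ w = w) :
    ∃ c : ℝ, v = c • w := by
  obtain ⟨k, -, hk⟩ := hN.exists_pos_pow
  -- With the minimal ratio as coefficient, the difference is nonnegative, fixed by `N` and zero at
  -- `i₀`; were it nonzero, `N ^ k` would make it positive there.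
  obtain ⟨i₀, hi₀⟩ := Finite.exists_min fun i => v i / w i
  refine ⟨v i₀ / w i₀, sub_eq_zero.1 ?_⟩
  by_contra hne
  have hfix : N *ᵥ (v - (v i₀ / w i₀) • w) = (1 : ℝ) • (v - (v i₀ / w i₀) • w) := by
    rw [mulVec_sub, mulVec_smul, hNv, hNw, one_smul]
  have := mulVec_pos_of_pos hk (x := v - (v i₀ / w i₀) • w)
    (fun i => by simpa using (le_div_iff₀ (hw i)).1 (hi₀ i)) hne i₀
  rw [pow_mulVec_eq_pow_smul hfix] at this
  simp [div_mul_cancel₀ _ (hw i₀).ne'] at this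

end Matrix

namespace MultiModel

variable {n : ℕ}

theorem IsFrobeniusEigenvalue.transpose {N : Matrix (Fin n) (Fin n) ℝ} {r : ℝ}
    (h : IsFrobeniusEigenvalue N r) : IsFrobeniusEigenvalue Nᵀ r := by
  have key : ∀ μ : ℂ, Module.End.HasEigenvalue (Matrix.toLin' (Nᵀ.map Complex.ofReal)) μ ↔
      Module.End.HasEigenvalue (Matrix.toLin' (N.map Complex.ofReal)) μ := fun μ => by
    rw [Module.End.hasEigenvalue_iff_isRoot_charpoly, Module.End.hasEigenvalue_iff_isRoot_charpoly,
      Matrix.charpoly_toLin', Matrix.charpoly_toLin', Matrix.transpose_map,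
      Matrix.charpoly_transpose]
  exact ⟨(key _).2 h.1, fun μ hμ => h.2 μ ((key μ).1 hμ)⟩

theorem hasEigenvalue_map_ofReal {N : Matrix (Fin n) (Fin n) ℝ} {r : ℝ} {v : Fin n → ℝ}
    (hv : v ≠ 0) (h : N *ᵥ v = r • v) :
    Module.End.HasEigenvalue (Matrix.toLin' (N.map Complex.ofReal)) (r : ℂ) := by
  refine Module.End.hasEigenvalue_of_hasEigenvector (x := fun i => (v i : ℂ))
    (Module.End.hasEigenvector_iff.2 ⟨Module.End.mem_eigenspace_iff.2 ?_, fun h0 => hv ?_⟩)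
  · funext i
    have := congrArg Complex.ofReal (congrFun h i)
    simpa [Matrix.mulVec, dotProduct] using this
  · funext i
    simpa using congrFun h0 i

/-- A primitive matrix with Frobenius eigenvalue `1` has a positive fixed vector. -/
theorem IsFrobeniusEigenvalue.exists_pos_fixed {N : Matrix (Fin n) (Fin n) ℝ}
    (h : IsFrobeniusEigenvalue N 1) (hN : N.IsPrimitive) :
    ∃ v : Fin n → ℝ, (∀ i, 0 < v i) ∧ N *ᵥ v = v := by
  obtain ⟨u, hu⟩ := h.1.exists_hasEigenvector
  obtain ⟨hu1, hu0⟩ := Module.End.hasEigenvector_iff.1 hu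
  have hu2 := Module.End.mem_eigenspace_iff.1 hu1
  -- By the triangle inequality the moduli of a complex fixed vector satisfy `x ≤ N x`. The
  -- resulting `r ≥ 1` is an eigenvalue, hence also at most `1`.
  obtain ⟨r, hr, v, hv0, hv, hNv⟩ := hN.exists_pos_eigenvector (x := fun i => ‖u i‖)
    (fun i => norm_nonneg _) (fun h0 => hu0 (funext fun i => norm_eq_zero.1 (congrFun h0 i)))
    fun i => by
      have h1 : ∑ j, (N i j : ℂ) * u j = u i := by
        simpa [Matrix.mulVec, dotProduct] using congrFun hu2 i
      calc ‖u i‖ = ‖∑ j, (N i j : ℂ) * u j‖ := by rw [h1]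
        _ ≤ ∑ j, ‖(N i j : ℂ) * u j‖ := norm_sum_le _ _
        _ = ∑ j, N i j * ‖u j‖ := by simp [abs_of_nonneg (hN.nonneg i _)]
  have hle := h.2 _ (hasEigenvalue_map_ofReal hv0 hNv)
  rw [Complex.norm_real, Real.norm_of_nonneg (zero_le_one.trans hr)] at hle
  refine ⟨v, hv, ?_⟩
  rw [hNv, le_antisymm hle hr, one_smul]

end MultiModel

end PerronFrobenius

/-! ### Similarities and Hausdorff measure -/

namespace MultiModel

namespace IsSimilarityMap

variable {X Y : Type*} [MetricSpace X] [MetricSpace Y] {K : ℝ} {f : X → Y}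

theorem edist_eq (hf : IsSimilarityMap K f) (x y : X) :
    edist (f x) (f y) = ENNReal.ofReal K * edist x y := by
  rw [edist_dist, edist_dist, hf.dist_eq, ENNReal.ofReal_mul hf.pos.le]

theorem lipschitzWith (hf : IsSimilarityMap K f) : LipschitzWith K.toNNReal f :=
  fun x y => (hf.edist_eq x y).le

theorem antilipschitzWith (hf : IsSimilarityMap K f) : AntilipschitzWith (K⁻¹).toNNReal f :=
  fun x y => by
    rw [hf.edist_eq, ← mul_assoc]
    change _ ≤ ENNReal.ofReal K⁻¹ * ENNReal.ofReal K * _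
    rw [← ENNReal.ofReal_mul (inv_nonneg.2 hf.pos.le), inv_mul_cancel₀ hf.pos.ne',
      ENNReal.ofReal_one, one_mul]

theorem hausdorffMeasure_univ_eq [MeasurableSpace X] [BorelSpace X] [MeasurableSpace Y]
    [BorelSpace Y] (hf : IsSimilarityMap K f) {d : ℝ} (hd : 0 ≤ d) :
    μH[d] (Set.univ : Set X) = ENNReal.ofReal (K⁻¹ ^ d) * μH[d] (Set.univ : Set Y) := by
  have h1 := hf.lipschitzWith.hausdorffMeasure_image_le hd Set.univ
  have h2 := hf.antilipschitzWith.le_hausdorffMeasure_image hd Set.univ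
  rw [Set.image_univ, hf.surjective.range_eq] at h1 h2
  have h3 : ENNReal.ofReal (K⁻¹ ^ d) = (ENNReal.ofReal K⁻¹) ^ d :=
    (ENNReal.ofReal_rpow_of_nonneg (inv_nonneg.2 hf.pos.le) hd).symm
  refine le_antisymm (h2.trans_eq (by rw [h3]; rfl)) ?_
  rw [h3]
  calc ENNReal.ofReal K⁻¹ ^ d * μH[d] (Set.univ : Set Y)
      ≤ ENNReal.ofReal K⁻¹ ^ d * (ENNReal.ofReal K ^ d * μH[d] (Set.univ : Set X)) := by
        gcongr
        exact h1
    _ = μH[d] (Set.univ : Set X) := by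
        rw [← mul_assoc, ← ENNReal.mul_rpow_of_nonneg _ _ hd,
          ← ENNReal.ofReal_mul (inv_nonneg.2 hf.pos.le), inv_mul_cancel₀ hf.pos.ne',
          ENNReal.ofReal_one, ENNReal.one_rpow, one_mul]

end IsSimilarityMap

/-! ### Transport along clone maps and conformal weights -/

namespace CloneStructure

variable {C : Type*} [MetricSpace C] {n m : ℕ} (S : CloneStructure C n m)

theorem scale_pos (k : Fin m) : 0 < S.scale k := (S.similarity k).pos

theorem loc_eq_of_subset {k : Fin m} {j : Fin n} (h : S.clone k ⊆ S.model j) : S.loc k = j := by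
  by_contra hne
  obtain ⟨x, hx⟩ := S.clone_partition.nonempty k
  exact Set.disjoint_left.1 (S.model_partition.disjoint hne) (S.clone_subset k hx) (h hx)

theorem exists_clone_mem {j : Fin n} {x : C} (hx : x ∈ S.model j) :
    ∃ k, S.loc k = j ∧ x ∈ S.clone k := by
  obtain ⟨k, hk⟩ := Set.mem_iUnion.1 (S.clone_partition.cover.ge (Set.mem_univ x))
  refine ⟨k, ?_, hk⟩
  by_contra hne
  exact Set.disjoint_left.1 (S.model_partition.disjoint hne) (S.clone_subset k hk) hx

theorem model_eq_biUnion (j : Fin n) :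
    S.model j = ⋃ k ∈ Finset.univ.filter fun k => S.loc k = j, S.clone k := by
  ext x
  simp only [Finset.mem_filter, Finset.mem_univ, true_and, Set.mem_iUnion, exists_prop]
  refine ⟨S.exists_clone_mem, ?_⟩
  rintro ⟨k, rfl, hx⟩
  exact S.clone_subset k hx

/-- The image of a set under a clone map. -/
def push (k : Fin m) (U : Set C) : Set C := Subtype.val '' (S.τ k '' (Subtype.val ⁻¹' U))

/-- The preimage of a set under a clone map. -/
def pull (k : Fin m) (U : Set C) : Set C := Subtype.val '' (S.τ k ⁻¹' (Subtype.val ⁻¹' U))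

theorem ediam_push_le (k : Fin m) (U : Set C) :
    Metric.ediam (S.push k U) ≤ ENNReal.ofReal (S.scale k) * Metric.ediam U := by
  refine Metric.ediam_le ?_
  rintro _ ⟨_, ⟨x, hx, rfl⟩, rfl⟩ _ ⟨_, ⟨y, hy, rfl⟩, rfl⟩
  have := (S.similarity k).edist_eq x y
  rw [Subtype.edist_eq, Subtype.edist_eq] at this
  rw [this]
  gcongr
  exact Metric.edist_le_ediam_of_mem hx hy

theorem ediam_pull_le (k : Fin m) (U : Set C) :
    Metric.ediam (S.pull k U) ≤ ENNReal.ofReal (S.scale k)⁻¹ * Metric.ediam U := by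
  refine Metric.ediam_le ?_
  rintro _ ⟨x, hx, rfl⟩ _ ⟨y, hy, rfl⟩
  have := (S.similarity k).antilipschitzWith x y
  rw [Subtype.edist_eq, Subtype.edist_eq] at this
  refine this.trans ?_
  change ENNReal.ofReal (S.scale k)⁻¹ * _ ≤ _
  gcongr
  exact Metric.edist_le_ediam_of_mem hx hy

theorem model_subset_push {ι : Type*} {F : Finset ι} {U : ι → Set C} {k : Fin m}
    (h : S.clone k ⊆ ⋃ i ∈ F, U i) : S.model (S.type k) ⊆ ⋃ i ∈ F, S.push k (U i) := by
  intro y hy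
  obtain ⟨x, hx⟩ := (S.similarity k).surjective ⟨y, hy⟩
  obtain ⟨i, hi, hxi⟩ := Set.mem_iUnion₂.1 (h x.2)
  exact Set.mem_iUnion₂.2 ⟨i, hi, _, ⟨x, hxi, rfl⟩, by rw [hx]⟩

theorem clone_subset_pull {ι : Type*} {U : ι → Set C} {k : Fin m}
    (h : S.model (S.type k) ⊆ ⋃ i, U i) : S.clone k ⊆ ⋃ i, S.pull k (U i) := by
  intro x hx
  obtain ⟨i, hi⟩ := Set.mem_iUnion.1 (h (S.τ k ⟨x, hx⟩).2)
  exact Set.mem_iUnion.2 ⟨i, ⟨x, hx⟩, hi, rfl⟩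

/-- The factor by which the inverse of a clone map multiplies the `d`-dimensional measure. -/
noncomputable def weight (d : ℝ) (k : Fin m) : ℝ≥0∞ := ENNReal.ofReal ((S.scale k)⁻¹ ^ d)

theorem weight_eq {d : ℝ} (hd : 0 ≤ d) (k : Fin m) :
    S.weight d k = ENNReal.ofReal (S.scale k)⁻¹ ^ d :=
  (ENNReal.ofReal_rpow_of_nonneg (inv_nonneg.2 (S.scale_pos k).le) hd).symm

theorem weight_mul_scale_rpow {d : ℝ} (hd : 0 ≤ d) (k : Fin m) :
    S.weight d k * ENNReal.ofReal (S.scale k) ^ d = 1 := by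
  rw [S.weight_eq hd, ← ENNReal.mul_rpow_of_nonneg _ _ hd,
    ← ENNReal.ofReal_mul (inv_nonneg.2 (S.scale_pos k).le), inv_mul_cancel₀ (S.scale_pos k).ne',
    ENNReal.ofReal_one, ENNReal.one_rpow]

/-- Transposition groups the clones by location instead of type, as additivity over a model
requires. -/
theorem transpose_matrix_mulVec (d : ℝ) (v : Fin n → ℝ) (j : Fin n) :
    ((S.matrix d)ᵀ *ᵥ v) j = ∑ k with S.loc k = j, (S.scale k)⁻¹ ^ d * v (S.type k) := by
  simp only [Matrix.mulVec, dotProduct, Matrix.transpose_apply, matrix, Matrix.of_apply,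
    Finset.sum_mul, Finset.sum_filter, ite_and]
  rw [Finset.sum_comm]
  refine Finset.sum_congr rfl fun k _ => ?_
  simp [ite_mul]

/-- A weight vector is conformal if the weight of a model is the sum of the weights of its clones,
when a clone gets the rescaled weight of its type. -/
def IsConformal (d : ℝ) (w : Fin n → ℝ≥0∞) : Prop :=
  ∀ j, w j = ∑ k with S.loc k = j, S.weight d k * w (S.type k)

theorem isConformal_ofReal {d : ℝ} {v : Fin n → ℝ} (hv : ∀ i, 0 ≤ v i)
    (h : (S.matrix d)ᵀ *ᵥ v = v) : S.IsConformal d fun i => ENNReal.ofReal (v i) := by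
  intro j
  have hs : ∀ k, 0 ≤ (S.scale k)⁻¹ ^ d :=
    fun k => Real.rpow_nonneg (inv_nonneg.2 (S.scale_pos k).le) d
  have hj := congrFun h j
  rw [transpose_matrix_mulVec] at hj
  dsimp only
  rw [← hj, ENNReal.ofReal_sum_of_nonneg fun k _ => mul_nonneg (hs k) (hv _)]
  exact Finset.sum_congr rfl fun k _ => ENNReal.ofReal_mul (hs k)

theorem IsConformal.mulVec_toReal {S : CloneStructure C n m} {d : ℝ} {w : Fin n → ℝ≥0∞}
    (h : S.IsConformal d w) (hw : ∀ i, w i ≠ ⊤) :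
    (S.matrix d)ᵀ *ᵥ (fun i => (w i).toReal) = fun i => (w i).toReal := by
  funext j
  rw [transpose_matrix_mulVec, h j, ENNReal.toReal_sum fun k _ =>
    ENNReal.mul_ne_top (by simp [weight]) (hw _)]
  refine Finset.sum_congr rfl fun k _ => ?_
  rw [ENNReal.toReal_mul, weight, ENNReal.toReal_ofReal
    (Real.rpow_nonneg (inv_nonneg.2 (S.scale_pos k).le) d)]

section Measure

variable [MeasurableSpace C] [BorelSpace C] {d : ℝ}

theorem hausdorffMeasure_clone (hd : 0 ≤ d) (k : Fin m) :
    μH[d] (S.clone k) = S.weight d k * μH[d] (S.model (S.type k)) := by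
  have h : ∀ s : Set C, μH[d] (Set.univ : Set s) = μH[d] s := fun s => by
    rw [← isometry_subtype_coe.hausdorffMeasure_image (Or.inl hd), Set.image_univ,
      Subtype.range_coe]
  rw [← h, ← h (S.model _)]
  exact (S.similarity k).hausdorffMeasure_univ_eq hd

theorem isConformal_hausdorffMeasure (hd : 0 ≤ d) :
    S.IsConformal d fun i => μH[d] (S.model i) := by
  intro j
  dsimp only
  rw [model_eq_biUnion, measure_biUnion_finset
    (fun k _ k' _ hk => S.clone_partition.disjoint hk)
    fun k _ => (S.clone_partition.isClopen k).isOpen.measurableSet]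
  exact Finset.sum_congr rfl fun k _ => S.hausdorffMeasure_clone hd k

theorem sum_hausdorffMeasure_model :
    ∑ i, μH[d] (S.model i) = μH[d] (Set.univ : Set C) := by
  rw [← S.model_partition.cover, measure_iUnion S.model_partition.disjoint
    fun k => (S.model_partition.isClopen k).isOpen.measurableSet, tsum_fintype]

end Measure

/-! ### Finiteness: covers by small clones -/

/-- An upper bound below one for the contraction ratios of the inverse clone maps. -/
theorem exists_ratio : ∃ ρ : ℝ≥0∞, ρ < 1 ∧ ∀ k, ENNReal.ofReal (S.scale k)⁻¹ ≤ ρ := by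
  refine ⟨Finset.univ.sup fun k => ENNReal.ofReal (S.scale k)⁻¹, ?_, fun k =>
    Finset.le_sup (f := fun k => ENNReal.ofReal (S.scale k)⁻¹) (Finset.mem_univ k)⟩
  refine (Finset.sup_lt_iff (by simp)).2 fun k _ => ?_
  rw [← ENNReal.ofReal_one, ENNReal.ofReal_lt_ofReal_iff zero_lt_one]
  exact inv_lt_one_of_one_lt₀ (S.one_lt_scale k)

/-- The covers of the models by the clones of level `r`. -/
theorem exists_cover {d : ℝ} (hd : 0 ≤ d) {w : Fin n → ℝ≥0∞} (hw : S.IsConformal d w)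
    {ρ D K : ℝ≥0∞} (hρ : ∀ k, ENNReal.ofReal (S.scale k)⁻¹ ≤ ρ)
    (hD : ∀ j, Metric.ediam (S.model j) ≤ D) (hK : ∀ j, Metric.ediam (S.model j) ^ d ≤ K * w j)
    (r : ℕ) : ∀ j, ∃ (ι : Type) (_ : Fintype ι) (t : ι → Set C), S.model j ⊆ ⋃ i, t i ∧
      (∀ i, Metric.ediam (t i) ≤ ρ ^ r * D) ∧ ∑ i, Metric.ediam (t i) ^ d ≤ K * w j := by
  induction r with
  | zero =>
    exact fun j => ⟨Unit, inferInstance, fun _ => S.model j, Set.subset_iUnion_of_subset () le_rfl,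
      by simpa using hD j, by simpa using hK j⟩
  | succ r ih =>
    choose ι hι t ht ht1 ht2 using ih
    intro j
    -- Each clone in the model receives the pulled-back level-`r` cover of its type.
    refine ⟨Σ k : {k // S.loc k = j}, ι (S.type k), inferInstance,
      fun p => S.pull p.1 (t _ p.2), ?_, ?_, ?_⟩
    · intro x hx
      obtain ⟨k, hk, hxk⟩ := S.exists_clone_mem hx
      obtain ⟨i, hi⟩ := Set.mem_iUnion.1 (S.clone_subset_pull (ht (S.type k)) hxk)
      exact Set.mem_iUnion.2 ⟨⟨⟨k, hk⟩, i⟩, hi⟩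
    · rintro ⟨⟨k, hk⟩, i⟩
      refine (S.ediam_pull_le k _).trans ?_
      rw [pow_succ', mul_assoc]
      exact mul_le_mul' (hρ k) (ht1 _ i)
    · rw [Fintype.sum_sigma]
      calc ∑ k : {k // S.loc k = j}, ∑ i, Metric.ediam (S.pull k (t (S.type k) i)) ^ d
          ≤ ∑ k : {k // S.loc k = j}, S.weight d k * (K * w (S.type k)) := by
            refine Finset.sum_le_sum fun k _ => ?_
            refine le_trans ?_ (mul_le_mul' le_rfl (ht2 (S.type k)))
            rw [Finset.mul_sum]
            refine Finset.sum_le_sum fun i _ => ?_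
            rw [S.weight_eq hd, ← ENNReal.mul_rpow_of_nonneg _ _ hd]
            exact ENNReal.rpow_le_rpow (S.ediam_pull_le k _) hd
        _ = ∑ k with S.loc k = j, S.weight d k * (K * w (S.type k)) :=
            (Finset.sum_subtype (p := fun k => S.loc k = j) _ (by simp)
              fun k => S.weight d k * (K * w (S.type k))).symm
        _ = K * w j := by
            rw [hw j, Finset.mul_sum]
            exact Finset.sum_congr rfl fun k _ => mul_left_comm _ _ _

theorem hausdorffMeasure_model_lt_top [CompactSpace C] [MeasurableSpace C] [BorelSpace C] {d : ℝ}
    (hd : 0 ≤ d) {w : Fin n → ℝ≥0∞} (hw : S.IsConformal d w) (hw0 : ∀ j, w j ≠ 0)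
    (hw1 : ∀ j, w j ≠ ⊤) (j : Fin n) : μH[d] (S.model j) < ⊤ := by
  obtain ⟨ρ, hρ1, hρ⟩ := S.exists_ratio
  have hDtop : Metric.ediam (Set.univ : Set C) ≠ ⊤ := isCompact_univ.isBounded.ediam_ne_top
  set D := Metric.ediam (Set.univ : Set C)
  have hD : ∀ j, Metric.ediam (S.model j) ≤ D := fun j => Metric.ediam_mono (Set.subset_univ _)
  -- Summing over all models gives one constant valid for every `j`.
  set K : ℝ≥0∞ := ∑ i, D ^ d / w i
  have hKtop : K ≠ ⊤ := ENNReal.sum_ne_top.2 fun i _ =>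
    ENNReal.div_ne_top (ENNReal.rpow_ne_top_of_nonneg hd hDtop) (hw0 i)
  have hK : ∀ j, Metric.ediam (S.model j) ^ d ≤ K * w j := fun j =>
    calc Metric.ediam (S.model j) ^ d ≤ D ^ d := ENNReal.rpow_le_rpow (hD j) hd
      _ = D ^ d / w j * w j := (ENNReal.div_mul_cancel (hw0 j) (hw1 j)).symm
      _ ≤ K * w j := by
        gcongr
        exact Finset.single_le_sum (f := fun i => D ^ d / w i) (fun _ _ => zero_le)
          (Finset.mem_univ j)
  choose ι hι t ht ht1 ht2 using fun r => S.exists_cover hd hw hρ hD hK r j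
  have hlim : Filter.Tendsto (fun r : ℕ => ρ ^ r * D) Filter.atTop (nhds 0) := by
    simpa using ENNReal.Tendsto.mul_const (ENNReal.tendsto_pow_atTop_nhds_zero_of_lt_one hρ1)
      (Or.inr hDtop)
  refine (Measure.hausdorffMeasure_le_liminf_sum d (S.model j) _ hlim t
    (Filter.Eventually.of_forall ht1) (Filter.Eventually.of_forall ht)).trans_lt ?_
  refine lt_of_le_of_lt ?_ (ENNReal.mul_lt_top hKtop.lt_top (hw1 j).lt_top)
  exact Filter.liminf_le_of_frequently_le' (Filter.Frequently.of_forall ht2)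

/-! ### Positivity: lower bounds for covers -/

/-- The mass distribution principle for finite covers of the models. -/
theorem le_sum_ediam_rpow_of_subset {d : ℝ} (hd : 0 ≤ d) {w : Fin n → ℝ≥0∞}
    (hw : S.IsConformal d w) {δ c : ℝ≥0∞}
    (hδ : ∀ U : Set C, U.Nonempty → Metric.ediam U < δ → ∃ k, U ⊆ S.clone k)
    (hc : ∀ j, c * w j ≤ δ ^ d) {ι : Type*} (F : Finset ι) :
    ∀ (U : ι → Set C) (j : Fin n), S.model j ⊆ ⋃ i ∈ F, U i →
      c * w j ≤ ∑ i ∈ F, Metric.ediam (U i) ^ d := by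
  classical
  induction F using Finset.strongInduction with
  | H F ih =>
  intro U j hF
  by_cases hbig : ∃ i ∈ F, δ ≤ Metric.ediam (U i)
  · obtain ⟨i, hi, hle⟩ := hbig
    exact ((hc j).trans (ENNReal.rpow_le_rpow hle hd)).trans
      (Finset.single_le_sum (f := fun i => Metric.ediam (U i) ^ d) (fun _ _ => zero_le) hi)
  push Not at hbig
  -- All remaining sets are small, so each nonempty one lies in a single clone and the families `G
  -- k` are disjoint.
  set G : Fin m → Finset ι := fun k => F.filter fun i => (U i ∩ S.clone k).Nonempty
  have hdisj : ∀ k k', k ≠ k' → Disjoint (G k) (G k') := by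
    intro k k' hkk'
    refine Finset.disjoint_left.2 fun i hi hi' => ?_
    obtain ⟨hiF, x, hxU, hxk⟩ := Finset.mem_filter.1 hi
    obtain ⟨-, y, hyU, hyk⟩ := Finset.mem_filter.1 hi'
    obtain ⟨l, hl⟩ := hδ (U i) ⟨x, hxU⟩ (hbig i hiF)
    have hin : ∀ {k z}, z ∈ U i → z ∈ S.clone k → l = k := fun {k z} hz hzk => by
      by_contra hne
      exact Set.disjoint_left.1 (S.clone_partition.disjoint hne) (hl hz) hzk
    exact hkk' ((hin hxU hxk).symm.trans (hin hyU hyk))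
  have hcov : ∀ k, S.loc k = j → S.clone k ⊆ ⋃ i ∈ G k, U i := by
    rintro k rfl x hx
    obtain ⟨i, hi, hxi⟩ := Set.mem_iUnion₂.1 (hF (S.clone_subset k hx))
    exact Set.mem_iUnion₂.2 ⟨i, Finset.mem_filter.2 ⟨hi, x, hxi, hx⟩, hxi⟩
  have hne : ∀ k, S.loc k = j → (G k).Nonempty := fun k hk => by
    obtain ⟨x, hx⟩ := S.clone_partition.nonempty k
    obtain ⟨i, hi, -⟩ := Set.mem_iUnion₂.1 (hcov k hk hx)
    exact ⟨i, hi⟩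
  -- A second clone in the same model needs its own nonempty family, so `G k` cannot exhaust `F`.
  have hss : ∀ k, S.loc k = j → G k ⊂ F := fun k hk => by
    refine (Finset.filter_subset _ _).ssubset_of_ne fun heq => ?_
    obtain ⟨k₁, k₂, h12, h1, h2⟩ := S.two_le j
    obtain ⟨k', hk', hkk'⟩ : ∃ k', S.loc k' = j ∧ k ≠ k' := by
      by_cases h : k = k₁
      · exact ⟨k₂, S.loc_eq_of_subset h2, h ▸ h12⟩
      · exact ⟨k₁, S.loc_eq_of_subset h1, h⟩
    obtain ⟨i, hi⟩ := hne k' hk'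
    refine Finset.disjoint_left.1 (hdisj k k' hkk') ?_ hi
    exact heq.ge (Finset.filter_subset _ _ hi)
  have hstep : ∀ k, S.loc k = j →
      S.weight d k * (c * w (S.type k)) ≤ ∑ i ∈ G k, Metric.ediam (U i) ^ d := fun k hk =>
    calc S.weight d k * (c * w (S.type k))
        ≤ S.weight d k * ∑ i ∈ G k, Metric.ediam (S.push k (U i)) ^ d :=
          mul_le_mul' le_rfl (ih (G k) (hss k hk) _ _ (S.model_subset_push (hcov k hk)))
      _ ≤ S.weight d k * ∑ i ∈ G k,
            ENNReal.ofReal (S.scale k) ^ d * Metric.ediam (U i) ^ d := by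
          gcongr with i
          rw [← ENNReal.mul_rpow_of_nonneg _ _ hd]
          exact ENNReal.rpow_le_rpow (S.ediam_push_le k _) hd
      _ = ∑ i ∈ G k, Metric.ediam (U i) ^ d := by
          rw [← Finset.mul_sum, ← mul_assoc, S.weight_mul_scale_rpow hd, one_mul]
  calc c * w j = ∑ k with S.loc k = j, S.weight d k * (c * w (S.type k)) := by
        rw [hw j, Finset.mul_sum]
        exact Finset.sum_congr rfl fun k _ => mul_left_comm _ _ _
    _ ≤ ∑ k with S.loc k = j, ∑ i ∈ G k, Metric.ediam (U i) ^ d :=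
        Finset.sum_le_sum fun k hk => hstep k (Finset.mem_filter.1 hk).2
    _ = ∑ i ∈ (Finset.univ.filter fun k => S.loc k = j).biUnion G, Metric.ediam (U i) ^ d :=
        (Finset.sum_biUnion fun k _ k' _ h => hdisj k k' h).symm
    _ ≤ ∑ i ∈ F, Metric.ediam (U i) ^ d :=
        Finset.sum_le_sum_of_subset (Finset.biUnion_subset.2 fun k _ => Finset.filter_subset _ _)

end CloneStructure

/-- A set of finite diameter has an open neighbourhood with almost the same `d`-th power of the
diameter. -/
theorem exists_isOpen_ediam_rpow_le {X : Type*} [MetricSpace X] {d : ℝ} (s : Set X)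
    (hs : Metric.ediam s ≠ ⊤) (hd : 0 ≤ d) {η : ℝ≥0∞} (hη : η ≠ 0) :
    ∃ U, IsOpen U ∧ s ⊆ U ∧ Metric.ediam U ^ d ≤ Metric.ediam s ^ d + η := by
  have hlim : Filter.Tendsto (fun ε : ℝ≥0 => (Metric.ediam s + 2 * (ε : ℝ≥0∞)) ^ d) (nhds 0)
      (nhds (Metric.ediam s ^ d)) := by
    have h1 : Continuous fun ε : ℝ≥0 => Metric.ediam s + 2 * (ε : ℝ≥0∞) :=
      continuous_const.add (ENNReal.continuous_const_mul (by simp) |>.comp ENNReal.continuous_coe)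
    have h2 := ((ENNReal.continuous_rpow_const (y := d)).comp h1).tendsto 0
    simpa [Function.comp_def] using h2
  have hlt : Metric.ediam s ^ d < Metric.ediam s ^ d + η :=
    ENNReal.lt_add_right (ENNReal.rpow_ne_top_of_nonneg hd hs) hη
  obtain ⟨ε, hε, hε0⟩ := (((hlim.eventually_lt_const hlt).filter_mono nhdsWithin_le_nhds).and
    (self_mem_nhdsWithin (s := Set.Ioi (0 : ℝ≥0)))).exists
  exact ⟨Metric.thickening ε s, Metric.isOpen_thickening,
    Metric.self_subset_thickening (NNReal.coe_pos.2 hε0) s,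
    (ENNReal.rpow_le_rpow (Metric.ediam_thickening_le ε) hd).trans hε.le⟩

namespace CloneStructure

variable {C : Type*} [MetricSpace C] {n m : ℕ} (S : CloneStructure C n m) [CompactSpace C]

/-- Sets of small diameter lie in a single clone. -/
theorem exists_lebesgue_number : ∃ δ > 0, δ ≠ ⊤ ∧
    ∀ U : Set C, U.Nonempty → Metric.ediam U < δ → ∃ k, U ⊆ S.clone k := by
  obtain ⟨δ, hδ, h⟩ := lebesgue_number_lemma_of_emetric isCompact_univ
    (fun k => (S.clone_partition.isClopen k).isOpen) S.clone_partition.cover.ge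
  refine ⟨min δ 1, lt_min hδ one_pos, ne_top_of_le_ne_top ENNReal.one_ne_top (min_le_right _ _),
    ?_⟩
  rintro U ⟨x, hx⟩ hU
  obtain ⟨k, hk⟩ := h x (Set.mem_univ x)
  exact ⟨k, fun y hy => hk ((Metric.edist_le_ediam_of_mem hy hx).trans_lt
    (hU.trans_le (min_le_left _ _)))⟩

theorem hausdorffMeasure_model_pos [MeasurableSpace C] [BorelSpace C] {d : ℝ}
    (hd : 0 < d) {w : Fin n → ℝ≥0∞} (hw : S.IsConformal d w) (hw0 : ∀ j, w j ≠ 0)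
    (hw1 : ∀ j, w j ≠ ⊤) (j : Fin n) : 0 < μH[d] (S.model j) := by
  obtain ⟨δ, hδ0, hδtop, hδ⟩ := S.exists_lebesgue_number
  have hδd : δ ^ d ≠ 0 := (ENNReal.rpow_pos hδ0 hδtop).ne'
  have hWtop : ∑ i, w i ≠ ⊤ := ENNReal.sum_ne_top.2 fun i _ => hw1 i
  have hc : ∀ j, δ ^ d / (∑ i, w i) * w j ≤ δ ^ d := fun j =>
    calc δ ^ d / (∑ i, w i) * w j ≤ δ ^ d / (∑ i, w i) * ∑ i, w i := by
          gcongr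
          exact Finset.single_le_sum (fun _ _ => zero_le) (Finset.mem_univ j)
      _ = δ ^ d := ENNReal.div_mul_cancel (fun h0 => hw0 j
          (Finset.sum_eq_zero_iff.1 h0 j (Finset.mem_univ j))) hWtop
  have hcpos : 0 < δ ^ d / (∑ i, w i) * w j :=
    ENNReal.mul_pos (ENNReal.div_ne_zero.2 ⟨hδd, hWtop⟩) (hw0 j)
  refine hcpos.trans_le ?_
  rw [Measure.hausdorffMeasure_apply]
  -- The lower bound holds for covers of any mesh, so the scale `1` is an arbitrary choice.
  refine le_iSup₂_of_le 1 one_pos (le_iInf fun t => le_iInf fun ht => le_iInf fun _ => ?_)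
  -- For empty sets this uses `0 ^ d = 0`, which needs `d > 0`.
  have hsimp : ∀ i, (⨆ _ : (t i).Nonempty, Metric.ediam (t i) ^ d) = Metric.ediam (t i) ^ d := by
    intro i
    rcases (t i).eq_empty_or_nonempty with h | h
    · simp [h, hd]
    · simp [h]
  simp only [hsimp]
  refine ENNReal.le_of_forall_pos_le_add fun η hη _ => ?_
  -- Enlarging the sets to open ones at total cost below `η` lets compactness extract a finite
  -- subcover.
  obtain ⟨η', hη', hsum⟩ := ENNReal.exists_pos_sum_of_countable' (ENNReal.coe_pos.2 hη).ne' ℕ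
  choose U hUo htU hU using fun i => exists_isOpen_ediam_rpow_le (t i)
    (ne_top_of_le_ne_top isCompact_univ.isBounded.ediam_ne_top
      (Metric.ediam_mono (Set.subset_univ _))) hd.le (hη' i).ne'
  obtain ⟨F, hF⟩ := (S.model_partition.isClopen j).isClosed.isCompact.elim_finite_subcover U hUo
    (ht.trans (Set.iUnion_mono htU))
  calc δ ^ d / (∑ i, w i) * w j ≤ ∑ i ∈ F, Metric.ediam (U i) ^ d :=
        S.le_sum_ediam_rpow_of_subset hd.le hw hδ hc F U j hF
    _ ≤ ∑' i, Metric.ediam (U i) ^ d := ENNReal.sum_le_tsum F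
    _ ≤ ∑' i, (Metric.ediam (t i) ^ d + η' i) := ENNReal.tsum_le_tsum hU
    _ ≤ ∑' i, Metric.ediam (t i) ^ d + η := by
        rw [ENNReal.tsum_add]
        gcongr

end CloneStructure

end MultiModel

/-! ### The main theorem -/

theorem theorem1 {C : Type*} [MetricSpace C] [MeasurableSpace C] [BorelSpace C]
    [Nonempty C] [CompactSpace C] [TotallyDisconnectedSpace C] [PerfectSpace C]
    {n m : ℕ} (S : MultiModel.CloneStructure C n m) (d : ℝ) (hd : 0 < d)
    (hprim : (S.matrix d).IsPrimitive)
    (hlam : MultiModel.IsFrobeniusEigenvalue (S.matrix d) 1) :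
    0 < μH[d] (Set.univ : Set C) ∧ μH[d] (Set.univ : Set C) < ⊤ ∧
    dimH (Set.univ : Set C) = ENNReal.ofReal d ∧
    MultiModel.IsFrobeniusEigenvector (S.matrix d).transpose 1
      (fun i => (μH[d] (S.model i)).toReal) ∧
    ∑ i, (μH[d] (S.model i)).toReal = (μH[d] (Set.univ : Set C)).toReal ∧
    ∀ v : Fin n → ℝ, MultiModel.IsFrobeniusEigenvector (S.matrix d).transpose 1 v →
      ∑ i, v i = (μH[d] (Set.univ : Set C)).toReal →
      ∀ i, v i = (μH[d] (S.model i)).toReal := by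

  obtain ⟨v₀, hv₀, hfix₀⟩ := hlam.transpose.exists_pos_fixed hprim.transpose
  have hw := S.isConformal_ofReal (fun i => (hv₀ i).le) hfix₀
  have hw0 : ∀ i, ENNReal.ofReal (v₀ i) ≠ 0 := fun i => (ENNReal.ofReal_pos.2 (hv₀ i)).ne'
  have hpos := S.hausdorffMeasure_model_pos hd hw hw0 fun _ => ENNReal.ofReal_ne_top
  have hfin := S.hausdorffMeasure_model_lt_top hd.le hw hw0 fun _ => ENNReal.ofReal_ne_top
  have hsum := S.sum_hausdorffMeasure_model (d := d)
  obtain ⟨i₀, -⟩ :=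
    Set.mem_iUnion.1 (S.model_partition.cover.ge (Set.mem_univ (Classical.arbitrary C)))
  have : Nonempty (Fin n) := ⟨i₀⟩
  have hCpos : 0 < μH[d] (Set.univ : Set C) :=
    (hpos i₀).trans_le (measure_mono (Set.subset_univ _))
  have hCfin : μH[d] (Set.univ : Set C) < ⊤ := by
    rw [← hsum]
    exact ENNReal.sum_lt_top.2 fun i _ => hfin i
  have hposR : ∀ i, 0 < (μH[d] (S.model i)).toReal :=
    fun i => ENNReal.toReal_pos (hpos i).ne' (hfin i).ne
  have hfix := (S.isConformal_hausdorffMeasure hd.le).mulVec_toReal fun i => (hfin i).ne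
  have hsumR : ∑ i, (μH[d] (S.model i)).toReal = (μH[d] (Set.univ : Set C)).toReal := by
    rw [← hsum, ENNReal.toReal_sum fun i _ => (hfin i).ne]
  refine ⟨hCpos, hCfin, ?_, ⟨hlam.transpose, hposR, by rw [hfix, one_smul]⟩, hsumR, ?_⟩
  · have hd' : ((d.toNNReal : ℝ≥0) : ℝ) = d := Real.coe_toNNReal d hd.le
    exact dimH_of_hausdorffMeasure_ne_zero_ne_top (by rw [hd']; exact hCpos.ne')
      (by rw [hd']; exact hCfin.ne)
  · intro v hv hvsum i
    -- Proportionality leaves one scalar, which the prescribed total forces to be `1`.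
    obtain ⟨c, rfl⟩ := hprim.transpose.exists_smul_eq hposR (by simpa using hv.eq) hfix
    simp only [Pi.smul_apply, smul_eq_mul, ← Finset.mul_sum, hsumR] at hvsum
    have hc : c = 1 := (mul_eq_right₀ (ENNReal.toReal_pos hCpos.ne' hCfin.ne).ne').1 hvsum
    rw [hc, one_smul]
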